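/- For a subset $A$ of a group $G$ with identity $e$ put $\Delta(A)=\{g\in G : gA\cap A \text{ is infinite}\}$, and let $\Delta^0(A)=A$, $\Delta^{n+1}(A)=\Delta(\Delta^n(A))$. Let $G$ be a countably infinite group such that for every $g\in G\setminus\{e\}$ the set $\{x\in G : x^2=g\}$ is finite. Then all of the following hold. 1. For every $X_0\subseteq G$ with $X_0=X_0^{-1}$ and $e\in X_0$ there is a sequence $(X_n)_{n\ge 0}$ of subsets of $G$, starting with the given $X_0$, such that $\Delta(X_{n+1})=X_n$ for all $n\ge 0$ and $X_m\cap X_n=\{e\}$ whenever $0<m<n$. 2. There is a family $(X_n)_{n\in\mathbb{Z}}$ of subsets of $G$ such that $\Delta(X_n)=X_{n+1}$ for all $n\in\mathbb{Z}$ and $X_m\cap X_n=\{e\}$ whenever $m\neq n$. 3. There is a nonempty subset $A\subseteq G$ such that $\Delta(A)=A$ and $A$ is not a subgroup of $G$. 4. There is a subset $A\subseteq G$ such that $A\supsetneq\Delta(A)\supsetneq\Delta^2(A)\supsetneq\cdots$. 5. There is a subset $A\subseteq G$ such that $A\subsetneq\Delta(A)\subsetneq\Delta^2(A)\subsetneq\cdots$.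 6. For every integer $n\ge 1$ there are subsets $X_0,\dots,X_{n-1}$ of $G$ such that $\Delta(X_i)=X_{i+1}$ for $0\le i<n-1$, $\Delta(X_{n-1})=X_0$, and $X_i\cap X_j=\{e\}$ whenever $0\le i<j<n$. -/

import Mathlib

open scoped Pointwise

/-- The combinatorial derivation `Δ(A) = {g ∈ G : gA ∩ A is infinite}` of a subset `A` of a group. -/
def combDeriv {G : Type*} [Group G] (A : Set G) : Set G :=
  {g : G | (g • A ∩ A).Infinite}

/-! A single generic construction serves all six parts. Each `X i` is to have as derivation a
symmetric set containing `1`, made of a fixed part `T i` and of members of the family itself. Every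
request `(i, g)` recurs infinitely often; each time `g` is already known to lie in the target, a
block `quad g x` joins `X i`, so that `g` becomes a derivation element. Blocks are symmetric because
the `X i` are themselves derivations, which always are. With `x` generic, a given `h` is a quotient
of two elements of the union only finitely often beyond the forced cases (`exists_generic_family`).
Blocks have quotients such as `x * x`, so the square-root hypothesis is what makes generic `x` exist
(`exists_generic`). Then Δ acts memberwise on unions (`combDeriv_biUnion`), and each part reduces to
a choice of index set: ℕ, ℤ or `ZMod n`. -/

/-- The symmetric set generated by `x` and `g * x`. -/
def quad {G : Type*} [Group G] (g x : G) : Set G :=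
  {x, g * x, x⁻¹, (g * x)⁻¹}

/-- The set that `combDeriv (X i)` is meant to be: a prescribed part `T i`, together with all
members `X j` of the family with `j ∈ R i`. -/
def derivTarget {ι G : Type*} (T : ι → Set G) (R : ι → Set ι) (X : ι → Set G) (i : ι) : Set G :=
  T i ∪ ⋃ j ∈ R i, X j

/-- The part of the `i`-th set recorded by the triples (index, translation, base point) in `S`. -/
def recorded {ι G : Type*} [Group G] (S : Set (ι × G × G)) (i : ι) : Set G :=
  insert 1 (⋃ d ∈ {d ∈ S | d.1 = i}, quad d.2.1 d.2.2)

/-- All elements recorded by the triples in `S`. -/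
def recordedAll {ι G : Type*} [Group G] (S : Set (ι × G × G)) : Set G :=
  insert 1 (⋃ d ∈ S, quad d.2.1 d.2.2)

/-! ### Generic blocks -/

section Quad

variable {G : Type*} [Group G]

theorem finite_quad (g x : G) : (quad g x).Finite := by
  unfold quad; exact Set.toFinite _

theorem left_mem_quad (g x : G) : x ∈ quad g x := by simp [quad]

theorem mul_mem_quad (g x : G) : g * x ∈ quad g x := by simp [quad]

theorem inv_mem_quad {g x q : G} (hq : q ∈ quad g x) : q⁻¹ ∈ quad g x := by
  simp only [quad, Set.mem_insert_iff, Set.mem_singleton_iff] at hq ⊢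
  rcases hq with rfl | rfl | rfl | rfl <;> simp

theorem finite_setOf_mem_quad (g b : G) : {x : G | b ∈ quad g x}.Finite := by
  refine Set.Finite.subset (Set.toFinite {b, g⁻¹ * b, b⁻¹, g⁻¹ * b⁻¹}) fun x hx => ?_
  simp only [quad, Set.mem_ofPred_eq, Set.mem_insert_iff, Set.mem_singleton_iff] at hx ⊢
  rcases hx with rfl | rfl | rfl | rfl <;> simp

/-- There are infinitely many `x` conjugating `g` to `g`, or else each fibre of
`x ↦ x⁻¹ * g * x` is finite. -/
theorem exists_infinite_finite_conj [Infinite G] (g : G) :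
    ∃ C : Set G, C.Infinite ∧ ∀ f, f ≠ g → {x ∈ C | x⁻¹ * (g * x) = f}.Finite := by
  by_cases hC : {x : G | x⁻¹ * (g * x) = g}.Infinite
  · refine ⟨_, hC, fun f hf => ?_⟩
    convert Set.finite_empty
    ext x
    simp only [Set.mem_ofPred_eq, Set.mem_empty_iff_false, iff_false, not_and]
    rintro h rfl
    exact hf h
  · rw [Set.not_infinite] at hC
    -- With a finite centralizer, each nonempty fibre is a translate of it.
    refine ⟨Set.univ, Set.infinite_univ, fun f _ => ?_⟩
    by_cases hne : ∃ y : G, y⁻¹ * (g * y) = f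
    · obtain ⟨y, rfl⟩ := hne
      refine (hC.image (· * y)).subset ?_
      rintro x ⟨-, hx⟩
      refine ⟨x * y⁻¹, ?_, by simp⟩
      have hx' : x⁻¹ * g * x = y⁻¹ * g * y := by simpa [mul_assoc] using hx
      calc (x * y⁻¹)⁻¹ * (g * (x * y⁻¹)) = y * (x⁻¹ * g * x) * y⁻¹ := by group
        _ = g := by rw [hx']; group
    · push Not at hne
      convert Set.finite_empty
      ext x
      simp [hne x]

theorem finite_setOf_mul_self_eq (hsqrt : ∀ g : G, g ≠ 1 → {x : G | x ^ 2 = g}.Finite)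
    (g : G) {f : G} (hf : f ≠ 1) : {x : G | g * x * (g * x) = f}.Finite := by
  refine ((hsqrt f hf).image (g⁻¹ * ·)).subset fun x hx => ⟨g * x, ?_, by simp⟩
  simpa [pow_two] using hx

theorem mul_inv_of_mem_quad {g x q q' : G} (hq : q ∈ quad g x) (hq' : q' ∈ quad g x) :
    q' * q⁻¹ ∈ ({1, g, g⁻¹} : Set G) ∨
      q' * q⁻¹ ∈ ({x * x, x * (g * x), g * x * x, g * x * (g * x), x⁻¹ * (g * x)} : Set G) ∨
      (q' * q⁻¹)⁻¹ ∈
        ({x * x, x * (g * x), g * x * x, g * x * (g * x), x⁻¹ * (g * x)} : Set G) := by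
  simp only [quad, Set.mem_insert_iff, Set.mem_singleton_iff] at hq hq' ⊢
  rcases hq with rfl | rfl | rfl | rfl <;> rcases hq' with rfl | rfl | rfl | rfl <;>
    simp [mul_assoc]

/-- Up to inversion a nontrivial quotient is a conjugate of `g`, controlled by `C`, or one of four
products, each reducing to a square: `x * (g * x) = f` means `(g * x)^2 = g * f`, and `g * x * x =
f` means `x^2 = g⁻¹ * f`. Excluding `1, g, g⁻¹` keeps these right-hand sides nontrivial. -/
theorem exists_infinite_finite_quotients [Infinite G]
    (hsqrt : ∀ g : G, g ≠ 1 → {x : G | x ^ 2 = g}.Finite) (g : G) :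
    ∃ C : Set G, C.Infinite ∧ ∀ f, f ∉ ({1, g, g⁻¹} : Set G) →
      {x ∈ C | ∃ q ∈ quad g x, ∃ q' ∈ quad g x, q' * q⁻¹ = f}.Finite := by
  obtain ⟨C, hC, hconj⟩ := exists_infinite_finite_conj g
  refine ⟨C, hC, ?_⟩
  have key : ∀ f, f ∉ ({1, g, g⁻¹} : Set G) → {x ∈ C | f ∈
      ({x * x, x * (g * x), g * x * x, g * x * (g * x), x⁻¹ * (g * x)} : Set G)}.Finite := by
    intro f hf
    simp only [Set.mem_insert_iff, Set.mem_singleton_iff, not_or] at hf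
    obtain ⟨h1, hg, hg'⟩ := hf
    have e1 := finite_setOf_mul_self_eq hsqrt 1 h1
    have e2 := finite_setOf_mul_self_eq hsqrt g (f := g * f)
      fun h => hg' (eq_inv_of_mul_eq_one_right h)
    have e3 := finite_setOf_mul_self_eq hsqrt 1 (f := g⁻¹ * f)
      fun h => hg (by simpa using (inv_mul_eq_one.mp h).symm)
    have e4 := finite_setOf_mul_self_eq hsqrt g h1
    refine ((((e1.union e2).union e3).union e4).union (hconj f hg)).subset ?_
    rintro x ⟨hxC, rfl | rfl | rfl | rfl | rfl⟩
    · simp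
    · simp [mul_assoc]
    · simp [mul_assoc]
    · simp
    · simp [hxC]
  intro f hf
  have hf' : f⁻¹ ∉ ({1, g, g⁻¹} : Set G) := by
    simp only [Set.mem_insert_iff, Set.mem_singleton_iff, not_or, inv_eq_one, inv_inj] at hf ⊢
    exact ⟨hf.1, fun h => hf.2.2 (by rw [← h, inv_inv]), hf.2.1⟩
  refine ((key f hf).union (key _ hf')).subset ?_
  rintro x ⟨hxC, q, hq, q', hq', rfl⟩
  exact ((mul_inv_of_mem_quad hq hq').resolve_left hf).imp (⟨hxC, ·⟩) (⟨hxC, ·⟩)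

/-- A base point whose quadruple avoids a finite set and has no quotient in a finite set other
than the unavoidable ones. -/
theorem exists_generic [Infinite G] (hsqrt : ∀ g : G, g ≠ 1 → {x : G | x ^ 2 = g}.Finite)
    {F B : Set G} (hF : F.Finite) (hB : B.Finite) (g : G) :
    ∃ x, (∀ q ∈ quad g x, q ∉ B) ∧ ∀ q ∈ quad g x, ∀ q' ∈ quad g x,
      q' * q⁻¹ ∈ F → q' * q⁻¹ ∈ ({1, g, g⁻¹} : Set G) := by
  obtain ⟨C, hC, hfin⟩ := exists_infinite_finite_quotients hsqrt g
  have h1 : (⋃ b ∈ B, {x : G | b ∈ quad g x}).Finite :=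
    hB.biUnion fun b _ => finite_setOf_mem_quad g b
  have h2 : (⋃ f ∈ F \ {1, g, g⁻¹},
      {x ∈ C | ∃ q ∈ quad g x, ∃ q' ∈ quad g x, q' * q⁻¹ = f}).Finite :=
    hF.sdiff.biUnion fun f hf => hfin f hf.2
  obtain ⟨x, hxC, hx⟩ := hC.exists_notMem_finite (h1.union h2)
  simp only [Set.mem_union, Set.mem_iUnion, not_or, not_exists] at hx
  refine ⟨x, fun q hq hqB => hx.1 q hqB hq, fun q hq q' hq' hqF => ?_⟩
  by_contra hcon
  exact hx.2 _ ⟨hqF, hcon⟩ ⟨hxC, q, hq, q', hq', rfl⟩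

end Quad

/-! ### Recursion and enumeration -/

theorem exists_seq_of_forall_finite {α : Type*} {P : ℕ → Set α → α → Prop}
    (h : ∀ n s, s.Finite → ∃ a, P n s a) : ∃ f : ℕ → α, ∀ n, P n (f '' Set.Iio n) (f n) := by
  classical
  have h' : ∀ n (s : Finset α), ∃ a, P n (s : Set α) a := fun n s => h n _ s.finite_toSet
  choose next hnext using h'
  obtain ⟨s, hs0, hs1⟩ : ∃ s : ℕ → Finset α, s 0 = ∅ ∧
      ∀ n, s (n + 1) = insert (next n (s n)) (s n) :=
    ⟨fun n => Nat.rec ∅ (fun n t => insert (next n t) t) n, rfl, fun _ => rfl⟩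
  have hs : ∀ n : ℕ, (fun k => next k (s k)) '' Set.Iio n = (s n : Set α) := by
    intro n
    induction n with
    | zero => simp [hs0]
    | succ n ih =>
      rw [hs1, Finset.coe_insert, ← ih, ← Set.image_insert_eq (f := fun k => next k (s k))]
      congr 1
      ext k
      simp only [Set.mem_insert_iff, Set.mem_Iio]
      omega
  refine ⟨fun n => next n (s n), fun n => ?_⟩
  rw [hs]
  exact hnext n (s n)

theorem exists_seq_frequently_eq (α : Type*) [Countable α] [Nonempty α] :
    ∃ t : ℕ → α, ∀ a, {n | t n = a}.Infinite := by
  obtain ⟨u, hu⟩ := exists_surjective_nat (α × ℕ)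
  refine ⟨fun n => (u n).1, fun a => ?_⟩
  choose v hv using fun k => hu (a, k)
  refine Set.infinite_of_injective_forall_mem (f := v) (fun k l hkl => ?_) fun k => ?_
  · have := (hv k).symm.trans ((congrArg u hkl).trans (hv l))
    exact (Prod.ext_iff.mp this).2
  · simp [hv]

theorem exists_finite_exhaustion (G : Type*) [Group G] [Countable G] :
    ∃ F : ℕ → Set G, (∀ n, (F n).Finite) ∧ (∀ n, 1 ∈ F n) ∧ (∀ n, ∀ g ∈ F n, g⁻¹ ∈ F n) ∧
      ∀ g, ∃ N, ∀ n ≥ N, g ∈ F n := by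
  obtain ⟨u, hu⟩ := exists_surjective_nat G
  refine ⟨fun n => insert 1 (u '' Set.Iic n ∪ (u '' Set.Iic n)⁻¹), fun n => ?_, fun n => by simp,
    fun n g hg => ?_, fun g => ?_⟩
  · exact (((Set.finite_Iic n).image u).union ((Set.finite_Iic n).image u).inv).insert 1
  · rcases hg with rfl | hg | hg
    · simp
    · exact Or.inr (Or.inr (by simpa using hg))
    · exact Or.inr (Or.inl hg)
  · obtain ⟨N, rfl⟩ := hu g
    exact ⟨N, fun n hn => Or.inr (Or.inl ⟨N, hn, rfl⟩)⟩

theorem derivTarget_mono {ι G : Type*} {T : ι → Set G} {R : ι → Set ι} {X Y : ι → Set G} (h : ∀ i, X i ⊆ Y i)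
    (i : ι) : derivTarget T R X i ⊆ derivTarget T R Y i :=
  Set.union_subset_union_right _ (Set.biUnion_mono subset_rfl fun j _ => h j)

theorem mem_derivTarget_iff {ι G : Type*} {T : ι → Set G} {R : ι → Set ι} {X : ι → Set G} {i : ι} {g : G} :
    g ∈ derivTarget T R X i ↔ g ∈ T i ∨ ∃ j ∈ R i, g ∈ X j := by
  simp [derivTarget]

section Recorded

variable {ι G : Type*} [Group G]

theorem finite_recordedAll {S : Set (ι × G × G)} (hS : S.Finite) : (recordedAll S).Finite :=
  (hS.biUnion fun _ _ => finite_quad _ _).insert 1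

theorem recorded_mono {S S' : Set (ι × G × G)} (h : S ⊆ S') (i : ι) :
    recorded S i ⊆ recorded S' i :=
  Set.insert_subset_insert (Set.biUnion_subset_biUnion_left fun _ hd => ⟨h hd.1, hd.2⟩)

theorem mem_recorded_iff {S : Set (ι × G × G)} {i : ι} {q : G} :
    q ∈ recorded S i ↔ q = 1 ∨ ∃ d ∈ S, d.1 = i ∧ q ∈ quad d.2.1 d.2.2 := by
  simp [recorded, and_assoc]

theorem mem_recordedAll_iff {S : Set (ι × G × G)} {q : G} :
    q ∈ recordedAll S ↔ q = 1 ∨ ∃ d ∈ S, q ∈ quad d.2.1 d.2.2 := by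
  simp [recordedAll]

theorem inv_mem_recorded {S : Set (ι × G × G)} {i : ι} {q : G} (hq : q ∈ recorded S i) :
    q⁻¹ ∈ recorded S i := by
  rw [mem_recorded_iff] at hq ⊢
  rcases hq with rfl | ⟨d, hd, hi, hq⟩
  · simp
  · exact Or.inr ⟨d, hd, hi, inv_mem_quad hq⟩

end Recorded

/-! ### The generic family -/

/-- A countable family of sets, meeting pairwise in `{1}`, that realizes the prescribed
derivations, and whose union has, for each `h`, only finitely many pairs `x, h * x` apart from
those forced by the prescription. -/
theorem exists_generic_family {ι G : Type*} [Countable ι] [Nonempty ι] [Group G] [Countable G]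
    [Infinite G] (hsqrt : ∀ g : G, g ≠ 1 → {x : G | x ^ 2 = g}.Finite)
    (T : ι → Set G) (hT1 : ∀ i, 1 ∈ T i) (hTinv : ∀ i, ∀ g ∈ T i, g⁻¹ ∈ T i) (R : ι → Set ι) :
    ∃ X : ι → Set G, (∀ i, 1 ∈ X i) ∧ (∀ i j, i ≠ j → X i ∩ X j = {1}) ∧
      (∀ i, ∀ h ∈ derivTarget T R X i, {x ∈ X i | h * x ∈ X i}.Infinite) ∧
      ∀ h, {x ∈ ⋃ i, X i | h * x ∈ ⋃ i, X i ∧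
        ¬ ∃ i, x ∈ X i ∧ h * x ∈ X i ∧ h ∈ derivTarget T R X i}.Finite := by
  classical
  obtain ⟨t, ht⟩ := exists_seq_frequently_eq (ι × G)
  obtain ⟨F, hFfin, hF1, hFinv, hFex⟩ := exists_finite_exhaustion G
  obtain ⟨d, hd⟩ := exists_seq_of_forall_finite (α := ι × G × G)
    (P := fun n S d => d.1 = (t n).1 ∧
      -- The target involves the sets under construction, so a request not yet justified is replaced
      -- by the harmless translation `1`.
      d.2.1 = (if (t n).2 ∈ derivTarget T R (recorded S) (t n).1 then (t n).2 else 1) ∧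
      (∀ q ∈ quad d.2.1 d.2.2, q ∉ F n * recordedAll S) ∧
      ∀ q ∈ quad d.2.1 d.2.2, ∀ q' ∈ quad d.2.1 d.2.2,
        q' * q⁻¹ ∈ F n → q' * q⁻¹ ∈ ({1, d.2.1, d.2.1⁻¹} : Set G))
    (fun n S hS => by
      obtain ⟨x, hx⟩ := exists_generic hsqrt (hFfin n) ((hFfin n).mul (finite_recordedAll hS))
        (if (t n).2 ∈ derivTarget T R (recorded S) (t n).1 then (t n).2 else 1)
      exact ⟨((t n).1, _, x), rfl, rfl, hx⟩)
  have hidx := fun n => (hd n).1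
  have htrans := fun n => (hd n).2.1
  have hdiff := fun n => (hd n).2.2.2
  have hnew : ∀ n, ∀ q ∈ quad (d n).2.1 (d n).2.2, ∀ b ∈ recordedAll (d '' Set.Iio n),
      q * b⁻¹ ∉ F n := fun n q hq b hb hqb =>
    (hd n).2.2.1 q hq ⟨q * b⁻¹, hqb, b, hb, by simp⟩
  have hold : ∀ {m n q}, m < n → q ∈ quad (d m).2.1 (d m).2.2 →
      q ∈ recordedAll (d '' Set.Iio n) := fun {m n q} hmn hq =>
    mem_recordedAll_iff.mpr (Or.inr ⟨d m, ⟨m, hmn, rfl⟩, hq⟩)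
  have hlt : ∀ {m n q}, m < n → q ∈ quad (d m).2.1 (d m).2.2 →
      q ∉ quad (d n).2.1 (d n).2.2 := fun {m n q} hmn hq hq' =>
    hnew n q hq' q (hold hmn hq) (by simpa using hF1 n)
  have huniq : ∀ {m n q}, q ∈ quad (d m).2.1 (d m).2.2 → q ∈ quad (d n).2.1 (d n).2.2 →
      m = n := by
    intro m n q hm hn
    rcases lt_trichotomy m n with h | h | h
    · exact (hlt h hm hn).elim
    · exact h
    · exact (hlt h hn hm).elim
  set X : ι → Set G := recorded (Set.range d) with hX
  have hmemX : ∀ n, quad (d n).2.1 (d n).2.2 ⊆ X (d n).1 := fun n q hq =>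
    mem_recorded_iff.mpr (Or.inr ⟨d n, ⟨n, rfl⟩, rfl, hq⟩)
  have hXiff : ∀ {i q}, q ∈ X i ↔ q = 1 ∨ ∃ n, (d n).1 = i ∧ q ∈ quad (d n).2.1 (d n).2.2 := by
    intro i q
    rw [hX, mem_recorded_iff]
    simp
  have hone : ∀ i, 1 ∈ X i := fun i => hXiff.mpr (Or.inl rfl)
  have htarget : ∀ n, (d n).2.1 ∈ derivTarget T R X (d n).1 := by
    intro n
    rw [htrans n, hidx n]
    split_ifs with h
    · exact derivTarget_mono (recorded_mono (Set.image_subset_range _ _)) _ h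
    · exact mem_derivTarget_iff.mpr (Or.inl (hT1 _))
  have htarget_inv : ∀ {i g}, g ∈ derivTarget T R X i → g⁻¹ ∈ derivTarget T R X i := by
    intro i g hg
    rw [mem_derivTarget_iff] at hg ⊢
    exact hg.imp (hTinv i g) fun ⟨j, hj, hg⟩ => ⟨j, hj, inv_mem_recorded hg⟩
  refine ⟨X, hone, fun i j hij => ?_, fun i h hh => ?_, fun h => ?_⟩
  · refine Set.Subset.antisymm (fun q hq => ?_) (by simp [hone])
    by_contra hq1
    obtain ⟨m, rfl, hm⟩ := (hXiff.mp hq.1).resolve_left hq1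
    obtain ⟨n, rfl, hn⟩ := (hXiff.mp hq.2).resolve_left hq1
    exact hij (by rw [huniq hm hn])
  -- Membership of `h` in the target is witnessed at a finite stage; all later requests `(i, h)` are
  -- honoured.
  · obtain ⟨N, hN⟩ : ∃ N, ∀ n ≥ N, h ∈ derivTarget T R (recorded (d '' Set.Iio n)) i := by
      rcases mem_derivTarget_iff.mp hh with hh | ⟨j, hj, hh⟩
      · exact ⟨0, fun n _ => mem_derivTarget_iff.mpr (Or.inl hh)⟩
      · rcases hXiff.mp hh with rfl | ⟨m, hm, hq⟩
        · exact ⟨0, fun n _ => mem_derivTarget_iff.mpr (Or.inl (hT1 i))⟩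
        · exact ⟨m + 1, fun n hn => mem_derivTarget_iff.mpr (Or.inr ⟨j, hj,
            mem_recorded_iff.mpr (Or.inr ⟨d m, ⟨m, hn, rfl⟩, hm, hq⟩)⟩)⟩
    have hinj : Function.Injective fun n => (d n).2.2 := fun m n hmn => by
      have h1 := left_mem_quad (d m).2.1 (d m).2.2
      have h2 := left_mem_quad (d n).2.1 (d n).2.2
      rw [← show (d m).2.2 = (d n).2.2 from hmn] at h2
      exact huniq h1 (by simpa [show (d m).2.2 = (d n).2.2 from hmn] using h2)
    have hinf : ({n | t n = (i, h)} \ Set.Iio N).Infinite := (ht (i, h)).sdiff (Set.finite_Iio N)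
    refine (hinf.image hinj.injOn).mono ?_
    rintro _ ⟨n, ⟨hn, hnN⟩, rfl⟩
    have hi : (d n).1 = i := by rw [hidx, show t n = (i, h) from hn]
    have hg : (d n).2.1 = h := by
      rw [htrans, show t n = (i, h) from hn, if_pos (hN n (by simpa using hnN))]
    have h1 := hmemX n (left_mem_quad (d n).2.1 (d n).2.2)
    have h2 := hmemX n (mul_mem_quad (d n).2.1 (d n).2.2)
    rw [hi] at h1 h2
    exact ⟨h1, by simpa only [hg] using h2⟩
  · obtain ⟨N, hN⟩ := hFex h
    have hB := finite_recordedAll ((Set.finite_Iio N).image d)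
    -- Exceptions need `x` or `h * x` recorded before stage `N`: later, distinct blocks are too far
    -- apart and one block yields only forced quotients.
    refine (hB.union (hB.image (h⁻¹ * ·))).subset ?_
    rintro x ⟨hx, hhx, hex⟩
    by_contra hcon
    have hbig : ∀ y ∈ ⋃ i, X i, y ∉ recordedAll (d '' Set.Iio N) →
        ∃ n ≥ N, y ∈ quad (d n).2.1 (d n).2.2 := by
      intro y hy hyB
      obtain ⟨i, hy⟩ := Set.mem_iUnion.mp hy
      rcases hXiff.mp hy with rfl | ⟨n, -, hn⟩
      · exact (hyB (mem_recordedAll_iff.mpr (Or.inl rfl))).elim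
      · exact ⟨n, not_lt.mp fun hlt => hyB (hold hlt hn), hn⟩
    obtain ⟨n, hn, hxn⟩ := hbig x hx fun hx => hcon (Or.inl hx)
    obtain ⟨m, hm, hxm⟩ := hbig (h * x) hhx fun hx => hcon (Or.inr ⟨_, hx, by simp⟩)
    rcases lt_trichotomy n m with hnm | rfl | hnm
    · exact hnew m _ hxm x (hold hnm hxn) (by simpa using hN m hm)
    · refine hex ⟨(d n).1, hmemX n hxn, hmemX n hxm, ?_⟩
      have := hdiff n x hxn (h * x) hxm (by simpa using hN n hn)
      rw [mul_inv_cancel_right] at this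
      rcases this with rfl | rfl | rfl
      · exact mem_derivTarget_iff.mpr (Or.inl (hT1 _))
      · exact htarget n
      · exact htarget_inv (htarget n)
    · exact hnew n x hxn (h * x) (hold hnm hxm) (by simpa using hFinv n h (hN n hn))

/-! ### Derivations of unions -/

section CombDeriv

variable {ι G : Type*} [Group G]

theorem mem_combDeriv_iff {A : Set G} {g : G} :
    g ∈ combDeriv A ↔ {x ∈ A | g * x ∈ A}.Infinite := by
  have : g • A ∩ A = (g * ·) '' {x ∈ A | g * x ∈ A} := by
    ext y
    constructor
    · rintro ⟨⟨x, hx, rfl⟩, hy⟩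
      exact ⟨x, ⟨hx, hy⟩, rfl⟩
    · rintro ⟨x, ⟨hx, hy⟩, rfl⟩
      exact ⟨⟨x, hx, rfl⟩, hy⟩
  change (g • A ∩ A).Infinite ↔ _
  rw [this, Set.infinite_image_iff (mul_right_injective g).injOn]

theorem infinite_of_one_mem_combDeriv {A : Set G} (h : 1 ∈ combDeriv A) : A.Infinite :=
  (mem_combDeriv_iff.mp h).mono fun _ hx => hx.1

theorem combDeriv_biUnion {X Y : ι → Set G} (hdisj : ∀ i j, i ≠ j → X i ∩ X j = {1})
    (hinf : ∀ i, ∀ h ∈ Y i, {x ∈ X i | h * x ∈ X i}.Infinite)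
    (hfin : ∀ h, {x ∈ ⋃ i, X i | h * x ∈ ⋃ i, X i ∧
        ¬ ∃ i, x ∈ X i ∧ h * x ∈ X i ∧ h ∈ Y i}.Finite) (J : Set ι) :
    combDeriv (⋃ j ∈ J, X j) = ⋃ j ∈ J, Y j := by
  ext h
  rw [mem_combDeriv_iff]
  constructor
  · intro hh
    -- Besides the exceptions, `x = 1` is avoided, so that `x` lies in only one member.
    obtain ⟨x, ⟨hx, hhx⟩, hne⟩ := hh.exists_notMem_finite ((hfin h).insert 1)
    have hsub : (⋃ j ∈ J, X j) ⊆ ⋃ i, X i := Set.iUnion₂_subset_iUnion J X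
    simp only [Set.mem_insert_iff, not_or] at hne
    have : ∃ i, x ∈ X i ∧ h * x ∈ X i ∧ h ∈ Y i := by
      by_contra hcon
      exact hne.2 ⟨hsub hx, hsub hhx, hcon⟩
    obtain ⟨i, hxi, -, hhi⟩ := this
    obtain ⟨j, hj, hxj⟩ := Set.mem_iUnion₂.mp hx
    obtain rfl : i = j := by
      by_contra hij
      exact hne.1 (by simpa [hdisj i j hij] using show x ∈ X i ∩ X j from ⟨hxi, hxj⟩)
    exact Set.mem_biUnion hj hhi
  · intro hh
    obtain ⟨j, hj, hhj⟩ := Set.mem_iUnion₂.mp hh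
    exact (hinf j h hhj).mono fun x hx => ⟨Set.mem_biUnion hj hx.1, Set.mem_biUnion hj hx.2⟩

/-- Along any self-map `s` of a countable index type there is a generic family with
`combDeriv (X i) = X (s i)`. -/
theorem exists_family_combDeriv_eq [Countable ι] [Nonempty ι] [Countable G] [Infinite G]
    (hsqrt : ∀ g : G, g ≠ 1 → {x : G | x ^ 2 = g}.Finite) (s : ι → ι) :
    ∃ X : ι → Set G, (∀ i, 1 ∈ X i) ∧ (∀ i j, i ≠ j → X i ∩ X j = {1}) ∧
      (∀ J : Set ι, combDeriv (⋃ j ∈ J, X j) = ⋃ j ∈ J, X (s j)) ∧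
      ∀ h, {x ∈ ⋃ i, X i | h * x ∈ ⋃ i, X i ∧
        ¬ ∃ i, x ∈ X i ∧ h * x ∈ X i ∧ h ∈ X (s i)}.Finite := by
  obtain ⟨X, hone, hdisj, hinf, hfin⟩ := exists_generic_family hsqrt (fun _ : ι => {1})
    (fun _ => rfl) (by simp) (fun i => {s i})
  have hY : derivTarget (fun _ : ι => {1}) (fun i => {s i}) X = fun i => X (s i) := by
    funext i
    simp [derivTarget, hone]
  rw [hY] at hinf hfin
  exact ⟨X, hone, hdisj, combDeriv_biUnion hdisj hinf hfin, hfin⟩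

theorem combDeriv_eq_of_biUnion {X : ι → Set G} {s : ι → ι}
    (h : ∀ J : Set ι, combDeriv (⋃ j ∈ J, X j) = ⋃ j ∈ J, X (s j)) (i : ι) :
    combDeriv (X i) = X (s i) := by
  simpa using h {i}

theorem iterate_combDeriv_eq {X : ℕ → Set G} (h : ∀ n, combDeriv (X n) = X (n + 1)) (n : ℕ) :
    combDeriv^[n] (X 0) = X n := by
  induction n with
  | zero => rfl
  | succ n ih => rw [Function.iterate_succ_apply', ih, h]

end CombDeriv

/-! ### The six conclusions -/

theorem exists_backward_chain {G : Type*} [Group G] [Countable G] [Infinite G]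
    (hsqrt : ∀ g : G, g ≠ 1 → {x : G | x ^ 2 = g}.Finite) (X₀ : Set G) (hinv : X₀ = X₀⁻¹)
    (hone₀ : (1 : G) ∈ X₀) :
    ∃ X : ℕ → Set G, X 0 = X₀ ∧ (∀ n, combDeriv (X (n + 1)) = X n) ∧
        ∀ m n : ℕ, 0 < m → m < n → X m ∩ X n = {1} := by
  obtain ⟨X, hone, hdisj, hinf, hfin⟩ := exists_generic_family hsqrt
    (fun n : ℕ => if n = 0 then X₀ else {1}) (fun n => by split_ifs <;> simp [hone₀])
    (fun n g hg => by
      split_ifs with h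
      · rw [if_pos h] at hg
        rw [hinv]
        simpa using hg
      · rw [if_neg h] at hg
        simpa using hg)
    -- The target of index `0` is `X₀`, that of `n + 1` is `X n`; prepending `X₀` shifts the indices
    -- by one.
    (fun n => {k | k + 1 = n})
  have hder := combDeriv_biUnion hdisj hinf hfin
  refine ⟨fun n => Nat.casesOn n X₀ X, rfl, fun n => ?_, fun m n hm hmn => ?_⟩
  · have := hder {n}
    simp only [Set.mem_singleton_iff, Set.iUnion_iUnion_eq_left] at this
    refine this.trans ?_
    cases n <;> simp [derivTarget, hone]
  · obtain ⟨m, rfl⟩ := Nat.exists_eq_succ_of_ne_zero hm.ne'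
    obtain ⟨n, rfl⟩ := Nat.exists_eq_succ_of_ne_zero (hm.trans hmn).ne'
    exact hdisj m n (by omega)

theorem exists_periodic_chain {G : Type*} [Group G] [Countable G] [Infinite G]
    (hsqrt : ∀ g : G, g ≠ 1 → {x : G | x ^ 2 = g}.Finite) (n : ℕ) (hn : 0 < n) :
    ∃ X : ℕ → Set G, (∀ i, i < n → combDeriv (X i) = X (i + 1)) ∧
      X n = X 0 ∧ ∀ i j : ℕ, i < j → j < n → X i ∩ X j = {1} := by
  have : NeZero n := ⟨hn.ne'⟩
  obtain ⟨X, -, hdisj, hder, -⟩ := exists_family_combDeriv_eq hsqrt (fun i : ZMod n => i + 1)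
  refine ⟨fun k => X k, fun i _ => ?_, by simp, fun i j hij hj => hdisj _ _ fun h => ?_⟩
  · simpa using combDeriv_eq_of_biUnion hder (i : ZMod n)
  · rw [ZMod.natCast_eq_natCast_iff', Nat.mod_eq_of_lt (hij.trans hj), Nat.mod_eq_of_lt hj] at h
    exact hij.ne h

theorem theorem5p4 {G : Type*} [Group G] [Countable G] [Infinite G]
    (hsqrt : ∀ g : G, g ≠ 1 → {x : G | x ^ 2 = g}.Finite) :
    -- backward chains from any symmetric set containing the identity
    (∀ X₀ : Set G, X₀ = X₀⁻¹ → (1 : G) ∈ X₀ →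
      ∃ X : ℕ → Set G, X 0 = X₀ ∧ (∀ n, combDeriv (X (n + 1)) = X n) ∧
        ∀ m n : ℕ, 0 < m → m < n → X m ∩ X n = {1}) ∧
    -- two-sided chains
    (∃ X : ℤ → Set G, (∀ n, combDeriv (X n) = X (n + 1)) ∧
      ∀ m n : ℤ, m ≠ n → X m ∩ X n = {1}) ∧
    -- nonempty fixed points that are not subgroups
    (∃ A : Set G, A.Nonempty ∧ combDeriv A = A ∧ ¬ ∃ H : Subgroup G, (H : Set G) = A) ∧
    -- strictly decreasing trajectories
    (∃ A : Set G, ∀ n : ℕ, combDeriv^[n + 1] A ⊂ combDeriv^[n] A) ∧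
    -- strictly increasing trajectories
    (∃ A : Set G, ∀ n : ℕ, combDeriv^[n] A ⊂ combDeriv^[n + 1] A) ∧
    -- periodic trajectories of every positive length
    (∀ n : ℕ, 0 < n → ∃ X : ℕ → Set G, (∀ i, i < n → combDeriv (X i) = X (i + 1)) ∧
      X n = X 0 ∧ ∀ i j : ℕ, i < j → j < n → X i ∩ X j = {1}) := by
  obtain ⟨X, hone, hdisj, hder, hfin⟩ := exists_family_combDeriv_eq hsqrt (fun n : ℤ => n + 1)
  have hX := combDeriv_eq_of_biUnion hder
  have hinf : ∀ n, (X n).Infinite := fun n =>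
    infinite_of_one_mem_combDeriv (by rw [hX]; exact hone _)
  have hshift : ∀ a b : Set ℤ, (∀ k, k ∈ b ↔ k - 1 ∈ a) →
      combDeriv (⋃ j ∈ a, X j) = ⋃ j ∈ b, X j := by
    intro a b hab
    rw [hder]
    ext x
    simp only [Set.mem_iUnion, exists_prop]
    exact ⟨fun ⟨j, hj, hx⟩ => ⟨j + 1, (hab _).mpr (by simpa using hj), hx⟩,
      fun ⟨j, hj, hx⟩ => ⟨j - 1, (hab _).mp hj, by simpa using hx⟩⟩
  have hstrict : ∀ a b : Set ℤ, a ⊂ b → a.Nonempty → (⋃ j ∈ a, X j) ⊂ ⋃ j ∈ b, X j := by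
    intro a b hab hne
    obtain ⟨k, hkb, hka⟩ := Set.exists_of_ssubset hab
    refine ⟨Set.biUnion_subset_biUnion_left hab.subset, fun hsub => ?_⟩
    obtain ⟨x, hx, hx1⟩ := (hinf k).exists_notMem_finite (Set.finite_singleton 1)
    obtain ⟨j, hj, hxj⟩ := Set.mem_iUnion₂.mp (hsub (Set.mem_biUnion hkb hx))
    have hjk : j ≠ k := fun h => hka (h ▸ hj)
    exact hx1 (by rw [← hdisj j k hjk]; exact ⟨hxj, hx⟩)
  refine ⟨exists_backward_chain hsqrt, ⟨X, hX, hdisj⟩, ⟨⋃ i, X i, ?_, ?_, ?_⟩, ?_, ?_,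
    exists_periodic_chain hsqrt⟩
  · exact ⟨1, Set.mem_iUnion.mpr ⟨0, hone 0⟩⟩
  · simpa using hshift Set.univ Set.univ (by simp)
  · rintro ⟨H, hH⟩
    obtain ⟨h, hh, hh1⟩ := (hinf 0).exists_notMem_finite (Set.finite_singleton 1)
    -- For nonexceptional `x`, closure under multiplication would force `h` into `X 0 ∩ X 1`.
    obtain ⟨x, hx, hxe⟩ := (hinf 0).exists_notMem_finite ((hfin h).insert 1)
    have hmem : ∀ {y}, y ∈ X 0 → y ∈ H := fun {y} hy => by
      rw [← SetLike.mem_coe, hH]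
      exact Set.mem_iUnion.mpr ⟨0, hy⟩
    have hhx : h * x ∈ ⋃ i, X i := hH ▸ H.mul_mem (hmem hh) (hmem hx)
    simp only [Set.mem_insert_iff, not_or] at hxe
    have : ∃ i, x ∈ X i ∧ h * x ∈ X i ∧ h ∈ X (i + 1) := by
      by_contra hcon
      exact hxe.2 ⟨Set.mem_iUnion.mpr ⟨0, hx⟩, hhx, hcon⟩
    obtain ⟨i, hxi, -, hhi⟩ := this
    obtain rfl : i = 0 := by
      by_contra hi
      exact hxe.1 (by simpa [hdisj i 0 hi] using show x ∈ X i ∩ X 0 from ⟨hxi, hx⟩)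
    exact hh1 (by rw [← hdisj 0 (0 + 1) (by simp)]; exact ⟨hh, hhi⟩)
  -- Δ shifts indices up by one, so it shrinks upper rays of ℤ and enlarges lower ones.
  · have hit := iterate_combDeriv_eq (X := fun n : ℕ => ⋃ j ∈ Set.Ici (n : ℤ), X j)
      fun n => hshift _ _ fun k => by simp only [Set.mem_Ici]; omega
    refine ⟨⋃ j ∈ Set.Ici ((0 : ℕ) : ℤ), X j, fun n => ?_⟩
    rw [hit, hit]
    exact hstrict _ _ (Set.Ici_ssubset_Ici.mpr (by simp)) Set.nonempty_Ici
  · have hit := iterate_combDeriv_eq (X := fun n : ℕ => ⋃ j ∈ Set.Iic (n : ℤ), X j)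
      fun n => hshift _ _ fun k => by simp only [Set.mem_Iic]; omega
    refine ⟨⋃ j ∈ Set.Iic ((0 : ℕ) : ℤ), X j, fun n => ?_⟩
    rw [hit, hit]
    exact hstrict _ _ (Set.Iic_ssubset_Iic.mpr (by simp)) Set.nonempty_Iic
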